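/- Let $p>2$ be a prime, let $\mathbb{F}=\mathbb{F}_q$ be a finite field of characteristic $p$, let $r$ be a prime and let $\mathbb{E}=\mathbb{F}_{q^r}$. Let $V$ be a vector space over $\mathbb{E}$ which, regarded as an $\mathbb{F}$-vector space, has finite dimension $d$ (so $r\mid d$ and $\dim_{\mathbb{E}}V=d/r$). Let $$H=\Gamma\mathrm{L}(d/r,\mathbb{F}_{q^r})=\mathrm{GL}(d/r,\mathbb{F}_{q^r})\rtimes\mathrm{Gal}(\mathbb{F}_{q^r}/\mathbb{F}_q)\le \mathrm{GL}(V)=\mathrm{GL}(d,\mathbb{F}_q)$$ be the group of all bijective maps of $V$ that are $\sigma$-semilinear over $\mathbb{E}$ for some $\sigma\in\mathrm{Gal}(\mathbb{E}/\mathbb{F})$. For $n\ge1$ let $L^nV=T^nV\cap L(V)$ be the $n$-th Lie power of the $\mathbb{F}$-space $V$, where $T^nV=V^{\otimes n}$ and $L(V)$ is the Lie subalgebra generated by $V$ in the tensor algebra $T(V)=\bigoplus_n T^nV$ over $\mathbb{F}$ under $[u,v]=u\otimes v-v\otimes u$; it is an $\mathbb{F}H$-module through $g(v_1\otimes\cdots\otimes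 v_n)=gv_1\otimes\cdots\otimes gv_n$. Call a module reducible if it has a nonzero proper submodule. Then: (i) If $1<r<d$, then $H$ acts reducibly on $L^2V$, and $L^2V$ has a nonzero quotient $H$-module of $\mathbb{F}$-dimension $\binom{d/r}{2}r$. (ii) If $3<r=d$, then $H$ acts reducibly on $L^2V$, and the smallest $\mathbb{F}$-dimension of a nonzero quotient $H$-module of $L^2V$ is $d$. (iii) If $r=d=3$ and $p>3$, then $H$ acts irreducibly on $L^2V$ and reducibly on $L^3V$. (iv) If $r=d=2$ and $p>3$, then $H$ acts irreducibly on $L^2V$ and on $L^3V$, and reducibly on $L^4V$. -/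

import Mathlib

noncomputable section

attribute [local instance] LieRing.ofAssociativeRing

/-- The free Lie algebra `L(V)` on `V`, as the closure of `V` under the bracket
`[u, v] = u ⊗ v - v ⊗ u` inside the tensor algebra `T(V)`. -/
def freeLie (F V : Type*) [Field F] [AddCommGroup V] [Module F V] :
    LieSubalgebra F (TensorAlgebra F V) :=
  LieSubalgebra.lieSpan F (TensorAlgebra F V) (Set.range (TensorAlgebra.ι F : V → TensorAlgebra F V))

/-- The `n`-th Lie power `L^n V = T^n V ∩ L(V)`. -/
def liePower (F V : Type*) [Field F] [AddCommGroup V] [Module F V] (n : ℕ) :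
    Submodule F (TensorAlgebra F V) :=
  (LinearMap.range (TensorAlgebra.ι F : V →ₗ[F] TensorAlgebra F V)) ^ n ⊓ (freeLie F V).toSubmodule

/-- The endomorphism of the tensor algebra induced by `g`:
`v₁ ⊗ ⋯ ⊗ vₙ ↦ g v₁ ⊗ ⋯ ⊗ g vₙ`. -/
def tensorAlgebraMap {F V : Type*} [Field F] [AddCommGroup V] [Module F V] (g : V ≃ₗ[F] V) :
    TensorAlgebra F V →ₐ[F] TensorAlgebra F V :=
  TensorAlgebra.lift F (TensorAlgebra.ι F ∘ₗ g.toLinearMap)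

theorem tensorAlgebraMap_ι {F V : Type*} [Field F] [AddCommGroup V] [Module F V]
    (g : V ≃ₗ[F] V) (v : V) :
    tensorAlgebraMap g (TensorAlgebra.ι F v) = TensorAlgebra.ι F (g v) := by
  simp [tensorAlgebraMap]

theorem tensorAlgebraMap_one {F V : Type*} [Field F] [AddCommGroup V] [Module F V] :
    tensorAlgebraMap (1 : V ≃ₗ[F] V) = AlgHom.id F (TensorAlgebra F V) := by
  apply TensorAlgebra.hom_ext
  ext v
  simp [tensorAlgebraMap_ι]

theorem tensorAlgebraMap_mul {F V : Type*} [Field F] [AddCommGroup V] [Module F V]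
    (g h : V ≃ₗ[F] V) :
    tensorAlgebraMap (g * h) = (tensorAlgebraMap g).comp (tensorAlgebraMap h) := by
  apply TensorAlgebra.hom_ext
  ext v
  simp [tensorAlgebraMap_ι]

theorem tensorAlgebraMap_mem_liePower {F V : Type*} [Field F] [AddCommGroup V] [Module F V]
    (g : V ≃ₗ[F] V) (n : ℕ) {x : TensorAlgebra F V} (hx : x ∈ liePower F V n) :
    tensorAlgebraMap g x ∈ liePower F V n := by
  obtain ⟨h1, h2⟩ := hx
  refine ⟨?_, ?_⟩
  · have h3 := Submodule.mem_map_of_mem (f := (tensorAlgebraMap g).toLinearMap) h1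
    rw [Submodule.map_pow] at h3
    have h5 : (LinearMap.range (TensorAlgebra.ι F : V →ₗ[F] TensorAlgebra F V)).map
        (tensorAlgebraMap g).toLinearMap ≤
        LinearMap.range (TensorAlgebra.ι F : V →ₗ[F] TensorAlgebra F V) := by
      rintro _ ⟨_, ⟨v, rfl⟩, rfl⟩
      exact ⟨g v, (tensorAlgebraMap_ι g v).symm⟩
    exact pow_le_pow_left' h5 n h3
  · have h4 : freeLie F V ≤ (freeLie F V).comap (tensorAlgebraMap g : _ →ₗ⁅F⁆ _) := by
      refine LieSubalgebra.lieSpan_le.2 ?_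
      rintro _ ⟨v, rfl⟩
      refine LieSubalgebra.subset_lieSpan ⟨g v, ?_⟩
      exact (tensorAlgebraMap_ι g v).symm
    exact h4 h2

/-- The natural action of `GL(V)` on `L^n V`. -/
def liePowerRep (F V : Type*) [Field F] [AddCommGroup V] [Module F V] (n : ℕ) :
    Representation F (V ≃ₗ[F] V) (liePower F V n) where
  toFun g := (tensorAlgebraMap g).toLinearMap.restrict
    fun _ hx => tensorAlgebraMap_mem_liePower g n hx
  map_one' := by
    ext x
    simp [tensorAlgebraMap_one]
  map_mul' g h := by
    ext x
    exact DFunLike.congr_fun (tensorAlgebraMap_mul g h) x.1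

/-- `ΓL(V)` for an `E`-vector space `V`, relative to the extension `E/F`: the group of those
invertible maps of `V` that are `σ`-semilinear for some `σ ∈ Gal(E/F)`, as a subgroup of the
general linear group of `V` over `F`. A choice of an `E`-basis of `V` identifies it with
`GL(m, E) ⋊ Gal(E/F)` for `m = dim_E V`. -/
def GammaL (F E V : Type*) [Field F] [Field E] [Algebra F E] [AddCommGroup V] [Module F V]
    [Module E V] : Subgroup (V ≃ₗ[F] V) where
  carrier := {g | ∃ σ : E ≃ₐ[F] E, ∀ (a : E) (v : V), g (a • v) = σ a • g v}
  one_mem' := ⟨1, fun _ _ => rfl⟩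
  mul_mem' := by
    rintro g h ⟨σ, hσ⟩ ⟨τ, hτ⟩
    exact ⟨σ * τ, fun a v => by simp [hσ, hτ]⟩
  inv_mem' := by
    rintro g ⟨σ, hσ⟩
    refine ⟨σ⁻¹, fun a v => ?_⟩
    apply g.injective
    rw [hσ]
    change g (g.symm (a • v)) = σ (σ.symm a) • g (g.symm v)
    simp

/-- The module `L^n V` restricted to the subgroup `H` of `GL(V)`. -/
def liePowerRes {F V : Type*} [Field F] [AddCommGroup V] [Module F V]
    (H : Subgroup (V ≃ₗ[F] V)) (n : ℕ) : Representation F H (liePower F V n) :=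
  (liePowerRep F V n).comp H.subtype

/-- A module is reducible if it has a proper nonzero submodule. -/
def IsReducibleRep {F G M : Type*} [Field F] [Group G] [AddCommGroup M] [Module F M]
    (ρ : Representation F G M) : Prop :=
  ∃ N : Subrepresentation ρ, N ≠ ⊥ ∧ N ≠ ⊤

/-- The dimensions of the nonzero quotient modules of `ρ`. -/
def quotientDims {F G M : Type*} [Field F] [Group G] [AddCommGroup M] [Module F M]
    (ρ : Representation F G M) : Set ℕ :=
  {k | ∃ N : Subrepresentation ρ, N ≠ ⊤ ∧ Module.finrank F (M ⧸ N.toSubmodule) = k}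

end

/-! Submodules arise as kernels of maps compatible with `GammaL`, and small subquotients are
excluded by the eigenvalues of one scalar operator.

If `dim_E V > 1`, then `[u, v] ↦ 2 u ∧ v` maps `L²V` onto the exterior square over `E`, of
`F`-dimension `choose (d/r) 2 * r`. Its kernel `exteriorKer` is stable under semilinear maps, and it
is nonzero because `dim L²V = choose d 2` (`finrank_liePower_two`) is larger.

If `r = d`, identify `V` with `E`. For Galois automorphisms `sᵢ`, the weight `v₁ ⊗ ⋯ ⊗ vₙ ↦ ∏
sᵢ(vᵢ)` is transformed semilinearly by the group (`weight_tensorAlgebraMap`), so its kernel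
`weightKer` is a submodule of codimension at most `r`. In degrees 3 and 4 this kernel is shown to be
nonzero by a Lie element that one weight kills and another does not.

For the lower bounds, take `a` in `E` outside `F`. Multiplication by `a` acts on `T²V = E ⊗ E` as `a
⊗ a`, with eigenvalues `a * b` for `b` conjugate to `a`. For odd `r` none lies in `F`, so each has
degree `r`, and every nonzero submodule or quotient of `L²V` has dimension at least `r`
(`le_finrank_subrepresentation`, `le_finrank_quotient`). This gives the minimum in (ii) and
irreducibility of the 3-dimensional `L²V` in (iii). In (iv), `L²V` is a line and `L³V = [L²V, V]`,
where scalars of `E` act transitively enough (`isIrreducible_liePower_three`). -/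

noncomputable section

attribute [local instance] LieRing.ofAssociativeRing

/-! ### Left-normed brackets and the upper bound for `dim L²V` -/

section LiePower

variable {F V : Type*} [Field F] [AddCommGroup V] [Module F V]

/-- The span of the left-normed brackets `[v₁, v₂, …, vₙ]` in the tensor algebra. -/
def leftNormedSpan (F V : Type*) [Field F] [AddCommGroup V] [Module F V] :
    ℕ → Submodule F (TensorAlgebra F V)
  -- The Lie algebra generated by `V` has no component in degree 0.
  | 0 => ⊥
  | 1 => LinearMap.range (TensorAlgebra.ι F : V →ₗ[F] TensorAlgebra F V)
  | n + 2 => Submodule.span F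
      {x | ∃ a ∈ leftNormedSpan F V (n + 1), ∃ v : V, x = ⁅a, TensorAlgebra.ι F v⁆}

theorem lie_ι_mem_iSup_leftNormedSpan {s : TensorAlgebra F V}
    (hs : s ∈ ⨆ n, leftNormedSpan F V n) (v : V) :
    ⁅s, TensorAlgebra.ι F v⁆ ∈ ⨆ n, leftNormedSpan F V n := by
  induction hs using Submodule.iSup_induction' with
  | mem m x hx =>
    match m, hx with
    | 0, hx =>
      have hx : x = 0 := by simpa [leftNormedSpan] using hx
      simp [hx]
    | m + 1, hx =>
      exact Submodule.mem_iSup_of_mem (m + 2) (Submodule.subset_span ⟨x, hx, v, rfl⟩)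
  | zero => simp
  | add x y _ _ hx hy => rw [add_lie]; exact add_mem hx hy

/-- The Jacobi identity `[s, [b, v]] = [[s, b], v] - [[s, v], b]` shortens the right entry, so
induction on its degree works as long as `s` stays arbitrary. -/
theorem lie_mem_iSup_leftNormedSpan (n : ℕ) {s a : TensorAlgebra F V}
    (hs : s ∈ ⨆ n, leftNormedSpan F V n) (ha : a ∈ leftNormedSpan F V n) :
    ⁅s, a⁆ ∈ ⨆ n, leftNormedSpan F V n := by
  induction n generalizing s a with
  | zero =>
    have ha : a = 0 := by simpa [leftNormedSpan] using ha
    simp [ha]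
  | succ n ih =>
    rcases n with _ | n
    · obtain ⟨v, rfl⟩ := ha
      exact lie_ι_mem_iSup_leftNormedSpan hs v
    · induction ha using Submodule.span_induction with
      | mem x hx =>
        obtain ⟨b, hb, v, rfl⟩ := hx
        have h : ⁅s, ⁅b, TensorAlgebra.ι F v⁆⁆ =
            ⁅⁅s, b⁆, TensorAlgebra.ι F v⁆ - ⁅⁅s, TensorAlgebra.ι F v⁆, b⁆ := by
          simp only [LieRing.of_associative_ring_bracket]
          noncomm_ring
        rw [h]
        exact sub_mem (lie_ι_mem_iSup_leftNormedSpan (ih hs hb) v)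
          (ih (lie_ι_mem_iSup_leftNormedSpan hs v) hb)
      | zero => simp
      | add x y _ _ hx hy => rw [lie_add]; exact add_mem hx hy
      | smul c x _ hx => rw [lie_smul]; exact Submodule.smul_mem _ c hx

theorem freeLie_le_iSup_leftNormedSpan :
    (freeLie F V).toSubmodule ≤ ⨆ n, leftNormedSpan F V n := by
  let S : LieSubalgebra F (TensorAlgebra F V) :=
    { (⨆ n, leftNormedSpan F V n : Submodule F (TensorAlgebra F V)) with
      lie_mem' := by
        intro x y hx hy
        change y ∈ ⨆ n, leftNormedSpan F V n at hy
        change x ∈ ⨆ n, leftNormedSpan F V n at hx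
        change ⁅x, y⁆ ∈ ⨆ n, leftNormedSpan F V n
        induction hy using Submodule.iSup_induction' with
        | mem m y hy => exact lie_mem_iSup_leftNormedSpan m hx hy
        | zero => simp
        | add y z _ _ hy hz => rw [lie_add]; exact add_mem hy hz }
  have h : freeLie F V ≤ S := by
    refine LieSubalgebra.lieSpan_le.2 ?_
    rintro _ ⟨v, rfl⟩
    exact Submodule.mem_iSup_of_mem (p := leftNormedSpan F V) 1 ⟨v, rfl⟩
  exact h

theorem ι_mem_liePower_one (v : V) : TensorAlgebra.ι F v ∈ liePower F V 1 :=
  ⟨by rw [pow_one]; exact ⟨v, rfl⟩, LieSubalgebra.subset_lieSpan ⟨v, rfl⟩⟩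

theorem lie_mem_liePower {m n : ℕ} {a b : TensorAlgebra F V} (ha : a ∈ liePower F V m)
    (hb : b ∈ liePower F V n) : ⁅a, b⁆ ∈ liePower F V (m + n) := by
  refine ⟨?_, (freeLie F V).lie_mem ha.2 hb.2⟩
  rw [LieRing.of_associative_ring_bracket]
  refine sub_mem ?_ ?_
  · rw [pow_add]; exact Submodule.mul_mem_mul ha.1 hb.1
  · rw [add_comm, pow_add]; exact Submodule.mul_mem_mul hb.1 ha.1

theorem leftNormedSpan_le_liePower (n : ℕ) : leftNormedSpan F V n ≤ liePower F V n := by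
  induction n with
  | zero => simp [leftNormedSpan]
  | succ n ih =>
    match n, ih with
    | 0, _ => rintro _ ⟨v, rfl⟩; exact ι_mem_liePower_one v
    | n + 1, ih =>
      refine Submodule.span_le.2 ?_
      rintro _ ⟨a, ha, v, rfl⟩
      exact lie_mem_liePower (ih ha) (ι_mem_liePower_one v)

/-- Left-normed brackets are homogeneous, so projecting a sum of them to degree `n` in the tensor
grading keeps only those of length `n`. -/
theorem liePower_eq_leftNormedSpan (n : ℕ) : liePower F V n = leftNormedSpan F V n := by
  refine le_antisymm ?_ (leftNormedSpan_le_liePower n)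
  rintro x ⟨hx, hx'⟩
  let 𝒜 : ℕ → Submodule F (TensorAlgebra F V) :=
    ((LinearMap.range (TensorAlgebra.ι F : V →ₗ[F] TensorAlgebra F V)) ^ ·)
  have key : ∀ y ∈ ⨆ m, leftNormedSpan F V m,
      (DirectSum.decompose 𝒜 y n : TensorAlgebra F V) ∈ leftNormedSpan F V n := by
    intro y hy
    induction hy using Submodule.iSup_induction' with
    | mem m y hy =>
      have h : y ∈ 𝒜 m := (leftNormedSpan_le_liePower m hy).1
      by_cases hmn : m = n
      · subst hmn
        rwa [DirectSum.decompose_of_mem_same 𝒜 h]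
      · rw [DirectSum.decompose_of_mem_ne 𝒜 h hmn]
        exact zero_mem _
    | zero => simp
    | add y z _ _ hy hz =>
      rw [DirectSum.decompose_add]
      exact add_mem hy hz
  have h := key x (freeLie_le_iSup_leftNormedSpan hx')
  rwa [DirectSum.decompose_of_mem_same 𝒜 hx] at h

instance liePower_finite [Module.Finite F V] (n : ℕ) : Module.Finite F (liePower F V n) := by
  have h : Module.Finite F
      ↥((LinearMap.range (TensorAlgebra.ι F : V →ₗ[F] TensorAlgebra F V)) ^ n) := by
    rw [Module.Finite.iff_fg, LinearMap.range_eq_map]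
    exact Submodule.FG.pow (Submodule.FG.map _ Module.Finite.fg_top) n
  exact Submodule.finiteDimensional_of_le inf_le_left

theorem liePower_two_eq_span : liePower F V 2 = Submodule.span F
    (Set.range fun v : Fin 2 → V => ⁅TensorAlgebra.ι F (v 0), TensorAlgebra.ι F (v 1)⁆) := by
  rw [liePower_eq_leftNormedSpan]
  refine congrArg _ (Set.ext fun x => ⟨?_, ?_⟩)
  · rintro ⟨_, ⟨u, rfl⟩, v, rfl⟩
    exact ⟨![u, v], rfl⟩
  · rintro ⟨v, rfl⟩
    exact ⟨_, ⟨v 0, rfl⟩, v 1, rfl⟩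

/-- The bracket `[v₁, v₂]` as an alternating map. -/
def bracketAlternating (F V : Type*) [Field F] [AddCommGroup V] [Module F V] :
    V [⋀^Fin 2]→ₗ[F] TensorAlgebra F V where
  toFun v := ⁅TensorAlgebra.ι F (v 0), TensorAlgebra.ι F (v 1)⁆
  map_update_add' v i x y := by
    fin_cases i <;> simp
  map_update_smul' v i c x := by
    fin_cases i <;> simp [LieRing.of_associative_ring_bracket, smul_sub]
  map_eq_zero_of_eq' v i j h hij := by
    fin_cases i <;> fin_cases j <;> simp_all

theorem finrank_liePower_two_le [Module.Finite F V] :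
    Module.finrank F (liePower F V 2) ≤ (Module.finrank F V).choose 2 := by
  have h : liePower F V 2 =
      LinearMap.range (exteriorPower.alternatingMapLinearEquiv (bracketAlternating F V)) := by
    rw [LinearMap.range_eq_map, ← exteriorPower.ιMulti_span, Submodule.map_span,
      liePower_two_eq_span, ← Set.range_comp]
    congr 2
    ext v
    simp [bracketAlternating]
  rw [h, ← exteriorPower.finrank_eq F 2]
  exact LinearMap.finrank_range_le _

end LiePower

end

noncomputable section

attribute [local instance] LieRing.ofAssociativeRing

/-! ### Galois weights on the tensor algebra of a one-dimensional `E`-space -/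

section Weight

variable {F E V : Type*} [Field F] [Field E] [Algebra F E] [AddCommGroup V] [Module F V]
  [Module E V] [IsScalarTower F E V]

/-- The linear map on the tensor algebra induced by an `n`-linear map, zero outside degree `n`. -/
def MultilinearMap.toTensorAlgebraHom {W : Type*} [AddCommGroup W] [Module F W] {n : ℕ}
    (f : MultilinearMap F (fun _ : Fin n => V) W) : TensorAlgebra F V →ₗ[F] W :=
  PiTensorProduct.lift f ∘ₗ DirectSum.component F ℕ (fun n => TensorPower F n V) n ∘ₗ
    TensorAlgebra.toDirectSum.toLinearMap

theorem MultilinearMap.toTensorAlgebraHom_tprod {W : Type*} [AddCommGroup W] [Module F W] {n : ℕ}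
    (f : MultilinearMap F (fun _ : Fin n => V) W) (x : Fin n → V) :
    f.toTensorAlgebraHom (TensorAlgebra.tprod F V n x) = f x := by
  simp only [toTensorAlgebraHom, LinearMap.comp_apply, AlgHom.toLinearMap_apply,
    TensorAlgebra.toDirectSum_tensorPower_tprod]
  rw [← DirectSum.lof_eq_of F, DirectSum.component.lof_self, PiTensorProduct.lift.tprod]

theorem MultilinearMap.toTensorAlgebraHom_tprod_of_ne {W : Type*} [AddCommGroup W] [Module F W]
    {m n : ℕ} (f : MultilinearMap F (fun _ : Fin n => V) W) (h : m ≠ n) (x : Fin m → V) :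
    f.toTensorAlgebraHom (TensorAlgebra.tprod F V m x) = 0 := by
  simp only [toTensorAlgebraHom, LinearMap.comp_apply, AlgHom.toLinearMap_apply,
    TensorAlgebra.toDirectSum_tensorPower_tprod]
  rw [← DirectSum.lof_eq_of F, DirectSum.component.of, dif_neg h]
  exact LinearMap.map_zero _

theorem TensorAlgebra.linearMap_ext_tprod {W : Type*} [AddCommGroup W] [Module F W]
    {f g : TensorAlgebra F V →ₗ[F] W}
    (h : ∀ (n : ℕ) (x : Fin n → V), f (tprod F V n x) = g (tprod F V n x)) : f = g := by
  have h' : f ∘ₗ (equivDirectSum (R := F) (M := V)).symm.toLinearMap =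
      g ∘ₗ (equivDirectSum (R := F) (M := V)).symm.toLinearMap := by
    refine DirectSum.linearMap_ext F fun n => PiTensorProduct.ext (MultilinearMap.ext fun x => ?_)
    simpa [DirectSum.lof_eq_of, -tprod_apply] using h n x
  ext x
  simpa using LinearMap.congr_fun h' (equivDirectSum x)

theorem tensorAlgebraMap_tprod (g : V ≃ₗ[F] V) {n : ℕ} (x : Fin n → V) :
    tensorAlgebraMap g (TensorAlgebra.tprod F V n x) =
      TensorAlgebra.tprod F V n (fun i => g (x i)) := by
  simp only [TensorAlgebra.tprod_apply, map_list_prod, List.map_ofFn]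
  congr 2
  funext i
  exact tensorAlgebraMap_ι g (x i)

/-- For a one-dimensional `E`-space `V` with coordinate `κ`, the functional
`v₁ ⊗ ⋯ ⊗ vₙ ↦ s₁ (κ v₁) ⋯ sₙ (κ vₙ)`. -/
def weight {n : ℕ} (κ : V ≃ₗ[E] E) (s : Fin n → E ≃ₐ[F] E) : TensorAlgebra F V →ₗ[F] E :=
  ((MultilinearMap.mkPiAlgebra F (Fin n) E).compLinearMap
    fun i => (s i).toLinearMap ∘ₗ κ.toLinearMap.restrictScalars F).toTensorAlgebraHom

theorem weight_tprod {n : ℕ} (κ : V ≃ₗ[E] E) (s : Fin n → E ≃ₐ[F] E) (x : Fin n → V) :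
    weight κ s (TensorAlgebra.tprod F V n x) = ∏ i, s i (κ (x i)) := by
  simp [weight, MultilinearMap.toTensorAlgebraHom_tprod, -TensorAlgebra.tprod_apply]

theorem weight_two (κ : V ≃ₗ[E] E) (s : Fin 2 → E ≃ₐ[F] E) (a b : V) :
    weight κ s (TensorAlgebra.ι F a * TensorAlgebra.ι F b) = s 0 (κ a) * s 1 (κ b) := by
  have h := weight_tprod κ s ![a, b]
  simpa [Fin.prod_univ_succ, List.ofFn_succ, mul_assoc] using h

theorem weight_three (κ : V ≃ₗ[E] E) (s : Fin 3 → E ≃ₐ[F] E) (a b c : V) :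
    weight κ s (TensorAlgebra.ι F a * TensorAlgebra.ι F b * TensorAlgebra.ι F c) =
      s 0 (κ a) * s 1 (κ b) * s 2 (κ c) := by
  have h := weight_tprod κ s ![a, b, c]
  simpa [Fin.prod_univ_succ, List.ofFn_succ, mul_assoc] using h

theorem weight_four (κ : V ≃ₗ[E] E) (s : Fin 4 → E ≃ₐ[F] E) (a b c d : V) :
    weight κ s (TensorAlgebra.ι F a * TensorAlgebra.ι F b * TensorAlgebra.ι F c *
      TensorAlgebra.ι F d) = s 0 (κ a) * s 1 (κ b) * s 2 (κ c) * s 3 (κ d) := by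
  have h := weight_tprod κ s ![a, b, c, d]
  simpa [Fin.prod_univ_succ, List.ofFn_succ, mul_assoc] using h

theorem weight_lie_two (κ : V ≃ₗ[E] E) (s : Fin 2 → E ≃ₐ[F] E) (a b : V) :
    weight κ s ⁅TensorAlgebra.ι F a, TensorAlgebra.ι F b⁆ =
      s 0 (κ a) * s 1 (κ b) - s 0 (κ b) * s 1 (κ a) := by
  simp only [LieRing.of_associative_ring_bracket, map_sub, weight_two]

theorem weight_lie_three (κ : V ≃ₗ[E] E) (s : Fin 3 → E ≃ₐ[F] E) (a b c : V) :
    weight κ s ⁅⁅TensorAlgebra.ι F a, TensorAlgebra.ι F b⁆, TensorAlgebra.ι F c⁆ =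
      s 0 (κ a) * s 1 (κ b) * s 2 (κ c) - s 0 (κ b) * s 1 (κ a) * s 2 (κ c) -
        (s 0 (κ c) * s 1 (κ a) * s 2 (κ b) - s 0 (κ c) * s 1 (κ b) * s 2 (κ a)) := by
  simp only [LieRing.of_associative_ring_bracket, map_sub, mul_sub, sub_mul, ← mul_assoc,
    weight_three]

theorem weight_lie_four (κ : V ≃ₗ[E] E) (s : Fin 4 → E ≃ₐ[F] E) (a b c d : V) :
    weight κ s ⁅⁅⁅TensorAlgebra.ι F a, TensorAlgebra.ι F b⁆, TensorAlgebra.ι F c⁆,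
        TensorAlgebra.ι F d⁆ =
      (s 0 (κ a) * s 1 (κ b) * s 2 (κ c) - s 0 (κ b) * s 1 (κ a) * s 2 (κ c) -
        (s 0 (κ c) * s 1 (κ a) * s 2 (κ b) - s 0 (κ c) * s 1 (κ b) * s 2 (κ a))) * s 3 (κ d) -
      s 0 (κ d) * (s 1 (κ a) * s 2 (κ b) * s 3 (κ c) - s 1 (κ b) * s 2 (κ a) * s 3 (κ c) -
        (s 1 (κ c) * s 2 (κ a) * s 3 (κ b) - s 1 (κ c) * s 2 (κ b) * s 3 (κ a))) := by
  simp only [LieRing.of_associative_ring_bracket, map_sub, mul_sub, sub_mul, ← mul_assoc,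
    weight_four]

/-- On a line, a `τ`-semilinear map is `τ` followed by multiplication by the image of the basis
vector. Commutativity of the Galois group lets `τ` be pulled out past every `sᵢ`. -/
theorem weight_tensorAlgebraMap (hcomm : ∀ σ τ : E ≃ₐ[F] E, σ * τ = τ * σ) {n : ℕ}
    (κ : V ≃ₗ[E] E) (s : Fin n → E ≃ₐ[F] E) {g : V ≃ₗ[F] V} {τ : E ≃ₐ[F] E}
    (hg : ∀ (a : E) (v : V), g (a • v) = τ a • g v) (x : TensorAlgebra F V) :
    weight κ s (tensorAlgebraMap g x) =
      (∏ i, s i (κ (g (κ.symm 1)))) * τ (weight κ s x) := by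
  have hκ : ∀ v, κ (g v) = τ (κ v) * κ (g (κ.symm 1)) := by
    intro v
    have hv : v = κ v • κ.symm 1 := by
      apply κ.injective
      simp
    conv_lhs => rw [hv, hg, map_smul, smul_eq_mul]
  have h : weight κ s ∘ₗ (tensorAlgebraMap g).toLinearMap =
      (LinearMap.mulLeft F (∏ i, s i (κ (g (κ.symm 1))))) ∘ₗ τ.toLinearMap ∘ₗ weight κ s := by
    refine TensorAlgebra.linearMap_ext_tprod fun m y => ?_
    simp only [LinearMap.comp_apply, AlgHom.toLinearMap_apply, tensorAlgebraMap_tprod,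
      LinearMap.mulLeft_apply, AlgEquiv.toLinearMap_apply]
    by_cases hm : m = n
    · subst hm
      rw [weight_tprod, weight_tprod, map_prod, ← Finset.prod_mul_distrib]
      refine Finset.prod_congr rfl fun i _ => ?_
      have hst : s i (τ (κ (y i))) = τ (s i (κ (y i))) := DFunLike.congr_fun (hcomm (s i) τ) _
      rw [hκ, map_mul, hst, mul_comm]
    · rw [weight, MultilinearMap.toTensorAlgebraHom_tprod_of_ne _ hm,
        MultilinearMap.toTensorAlgebraHom_tprod_of_ne _ hm, map_zero, mul_zero]
  exact LinearMap.congr_fun h x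

/-- The kernel of a weight functional on `L^n V`, as a `ΓL(V)`-submodule. -/
def weightKer (hcomm : ∀ σ τ : E ≃ₐ[F] E, σ * τ = τ * σ) {n : ℕ}
    (κ : V ≃ₗ[E] E) (s : Fin n → E ≃ₐ[F] E) :
    Subrepresentation (liePowerRes (GammaL F E V) n) where
  toSubmodule := LinearMap.ker (weight κ s ∘ₗ (liePower F V n).subtype)
  apply_mem_toSubmodule := by
    rintro ⟨g, τ, hg⟩ x hx
    have hx' : weight κ s (x : TensorAlgebra F V) = 0 := hx
    change weight κ s (tensorAlgebraMap g (x : TensorAlgebra F V)) = 0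
    rw [weight_tensorAlgebraMap hcomm κ s hg, hx', map_zero, mul_zero]

theorem weightKer_ne_top (hcomm : ∀ σ τ : E ≃ₐ[F] E, σ * τ = τ * σ) {n : ℕ}
    (κ : V ≃ₗ[E] E) (s : Fin n → E ≃ₐ[F] E) {x : TensorAlgebra F V} (hx : x ∈ liePower F V n)
    (h : weight κ s x ≠ 0) : weightKer hcomm κ s ≠ ⊤ := by
  intro htop
  have hmem : (⟨x, hx⟩ : liePower F V n) ∈ (weightKer hcomm κ s).toSubmodule := by
    rw [htop]; exact Submodule.mem_top
  exact h hmem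

theorem weightKer_ne_bot (hcomm : ∀ σ τ : E ≃ₐ[F] E, σ * τ = τ * σ) {n : ℕ}
    (κ : V ≃ₗ[E] E) (s : Fin n → E ≃ₐ[F] E) {x : TensorAlgebra F V} (hx : x ∈ liePower F V n)
    (h : weight κ s x = 0) (h0 : x ≠ 0) : weightKer hcomm κ s ≠ ⊥ := by
  intro hbot
  have hmem : (⟨x, hx⟩ : liePower F V n) ∈ (weightKer hcomm κ s).toSubmodule := h
  rw [hbot] at hmem
  exact h0 (congrArg Subtype.val ((Submodule.mem_bot F).1 hmem))

end Weight

end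

noncomputable section

attribute [local instance] LieRing.ofAssociativeRing

/-! ### The exterior square over `E` as a quotient of `L²V` -/

section Exterior

/-- A copy of `A` whose `E`-algebra structure is twisted by `σ`. -/
def TwistedAlgebra {E : Type*} [Field E] (_ : E →+* E) (A : Type*) : Type _ := A

instance {E : Type*} [Field E] (σ : E →+* E) (A : Type*) [Ring A] : Ring (TwistedAlgebra σ A) :=
  inferInstanceAs (Ring A)

instance {E : Type*} [Field E] (σ : E →+* E) (A : Type*) [Ring A] [Algebra E A] :
    Algebra E (TwistedAlgebra σ A) :=
  ((algebraMap E A).comp σ).toAlgebra' fun c x => Algebra.commutes (A := A) (σ c) x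

theorem TwistedAlgebra.smul_eq {E : Type*} [Field E] (σ : E →+* E) (A : Type*) [Ring A]
    [Algebra E A] (c : E) (x : A) :
    (c • (show TwistedAlgebra σ A from x) : TwistedAlgebra σ A) = (σ c • x : A) :=
  (Algebra.smul_def (A := A) (σ c) x).symm

/-- A semilinear map of `V` extends to a ring endomorphism of the exterior algebra. -/
theorem ExteriorAlgebra.exists_ringHom_of_semilinear {E V : Type*} [Field E] [AddCommGroup V]
    [Module E V] (σ : E →+* E) (g : V →+ V) (hg : ∀ (a : E) (v : V), g (a • v) = σ a • g v) :
    ∃ φ : ExteriorAlgebra E V →+* ExteriorAlgebra E V,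
      (∀ v, φ (ExteriorAlgebra.ι E v) = ExteriorAlgebra.ι E (g v)) ∧
      ∀ a : E, φ (algebraMap E _ a) = algebraMap E _ (σ a) := by
  -- With the target twisted by `σ`, the semilinear `v ↦ ι (g v)` becomes `E`-linear, and the
  -- universal property of the exterior algebra applies.
  let f : V →ₗ[E] TwistedAlgebra σ (ExteriorAlgebra E V) :=
    { toFun := fun v => (ExteriorAlgebra.ι E (g v) : ExteriorAlgebra E V)
      map_add' := fun u v => by
        change (ExteriorAlgebra.ι E (g (u + v)) : ExteriorAlgebra E V) =
          ExteriorAlgebra.ι E (g u) + ExteriorAlgebra.ι E (g v)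
        rw [map_add, map_add]
      map_smul' := fun a v => by
        refine Eq.trans ?_ (TwistedAlgebra.smul_eq σ (ExteriorAlgebra E V) a (ExteriorAlgebra.ι E (g v))).symm
        rw [hg, map_smul] }
  have hf : ∀ v, f v * f v = 0 := fun v => ExteriorAlgebra.ι_sq_zero (R := E) (g v)
  let ψ := ExteriorAlgebra.lift E ⟨f, hf⟩
  refine ⟨(ψ : ExteriorAlgebra E V →+* TwistedAlgebra σ (ExteriorAlgebra E V)), ?_, ?_⟩
  · intro v
    exact ExteriorAlgebra.lift_ι_apply E f hf v
  · intro a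
    exact ψ.commutes a

variable (F E V : Type*) [Field F] [Field E] [Algebra F E] [AddCommGroup V] [Module F V]
  [Module E V] [IsScalarTower F E V]

/-- The natural map from the tensor algebra over `F` to the exterior algebra over `E`. -/
def tensorToExterior : TensorAlgebra F V →ₐ[F] ExteriorAlgebra E V :=
  TensorAlgebra.lift F ((ExteriorAlgebra.ι E : V →ₗ[E] ExteriorAlgebra E V).restrictScalars F)

theorem tensorToExterior_ι (v : V) :
    tensorToExterior F E V (TensorAlgebra.ι F v) = ExteriorAlgebra.ι E v := by
  simp [tensorToExterior]

variable {F E V}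

theorem tensorToExterior_tensorAlgebraMap_eq_zero {g : V ≃ₗ[F] V} {τ : E ≃ₐ[F] E}
    (hg : ∀ (a : E) (v : V), g (a • v) = τ a • g v) {x : TensorAlgebra F V}
    (hx : tensorToExterior F E V x = 0) :
    tensorToExterior F E V (tensorAlgebraMap g x) = 0 := by
  obtain ⟨φ, hφ, hφ'⟩ := ExteriorAlgebra.exists_ringHom_of_semilinear (τ : E →+* E)
    (g : V →+ V) hg
  have key : ∀ y, tensorToExterior F E V (tensorAlgebraMap g y) =
      φ (tensorToExterior F E V y) := by
    intro y
    induction y using TensorAlgebra.induction with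
    | algebraMap c =>
      rw [AlgHom.commutes, AlgHom.commutes,
        IsScalarTower.algebraMap_apply F E (ExteriorAlgebra E V), hφ']
      congr 1
      exact (τ.commutes c).symm
    | ι v =>
      rw [tensorAlgebraMap_ι, tensorToExterior_ι, tensorToExterior_ι, hφ]
      rfl
    | mul a b ha hb => rw [map_mul, map_mul, map_mul, ha, hb, map_mul]
    | add a b ha hb => rw [map_add, map_add, map_add, ha, hb, map_add]
  rw [key, hx, map_zero]

theorem tensorToExterior_lie (u v : V) :
    tensorToExterior F E V ⁅TensorAlgebra.ι F u, TensorAlgebra.ι F v⁆ =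
      (2 : E) • ExteriorAlgebra.ιMulti E 2 ![u, v] := by
  have h := ExteriorAlgebra.ι_add_mul_swap (R := E) u v
  simp only [LieRing.of_associative_ring_bracket, map_sub, map_mul, tensorToExterior_ι,
    ExteriorAlgebra.ιMulti_apply, List.ofFn_succ, two_smul]
  simp
  rw [← eq_neg_iff_add_eq_zero] at h
  rw [h]
  abel

theorem map_tensorToExterior_liePower_two (h2 : (2 : E) ≠ 0) :
    (liePower F V 2).map (tensorToExterior F E V).toLinearMap =
      (⋀[E]^2 V).restrictScalars F := by
  apply le_antisymm
  · rintro _ ⟨x, hx, rfl⟩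
    rw [SetLike.mem_coe, liePower_two_eq_span] at hx
    induction hx using Submodule.span_induction with
    | mem x hx =>
      obtain ⟨v, rfl⟩ := hx
      refine (congrArg (· ∈ (⋀[E]^2 V).restrictScalars F)
        (tensorToExterior_lie (E := E) (v 0) (v 1))).mpr ?_
      exact Submodule.smul_mem (⋀[E]^2 V) _ (ExteriorAlgebra.ιMulti_range E 2 ⟨_, rfl⟩)
    | zero => rw [map_zero]; exact zero_mem _
    | add x y _ _ hx hy => rw [map_add]; exact add_mem hx hy
    | smul c x _ hx => rw [map_smul]; exact Submodule.smul_mem _ c hx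
  · intro x hx
    replace hx : x ∈ ⋀[E]^2 V := hx
    rw [← ExteriorAlgebra.ιMulti_span_fixedDegree] at hx
    induction hx using Submodule.closure_induction with
    | zero => exact zero_mem _
    | add x y _ _ hx hy => exact add_mem hx hy
    | smul_mem a x hx =>
      obtain ⟨v, rfl⟩ := hx
      -- The source is only an `F`-space, so the scalar from `E` is absorbed into the first entry;
      -- `2⁻¹` cancels the factor 2 in the image of a bracket.
      refine ⟨⁅TensorAlgebra.ι F ((2⁻¹ * a) • v 0), TensorAlgebra.ι F (v 1)⁆,
        lie_mem_liePower (ι_mem_liePower_one _) (ι_mem_liePower_one _), ?_⟩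
      rw [AlgHom.toLinearMap_apply, tensorToExterior_lie]
      have hv : (![(2⁻¹ * a) • v 0, v 1] : Fin 2 → V) = Function.update v 0 ((2⁻¹ * a) • v 0) := by
        ext i; fin_cases i <;> simp
      rw [hv, (ExteriorAlgebra.ιMulti E 2).map_update_smul, Function.update_eq_self, smul_smul,
        mul_inv_cancel_left₀ h2]

variable (F E V) in
/-- The kernel of `L²V → Λ²_E V`, as a `ΓL(V)`-submodule. -/
def exteriorKer : Subrepresentation (liePowerRes (GammaL F E V) 2) where
  toSubmodule := LinearMap.ker ((tensorToExterior F E V).toLinearMap ∘ₗ (liePower F V 2).subtype)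
  apply_mem_toSubmodule := by
    rintro ⟨g, τ, hg⟩ x hx
    exact tensorToExterior_tensorAlgebraMap_eq_zero hg hx

theorem finrank_range_tensorToExterior [Module.Finite E V] (h2 : (2 : E) ≠ 0) :
    Module.finrank F (LinearMap.range
      ((tensorToExterior F E V).toLinearMap ∘ₗ (liePower F V 2).subtype)) =
      (Module.finrank E V).choose 2 * Module.finrank F E := by
  rw [LinearMap.range_comp, Submodule.range_subtype, map_tensorToExterior_liePower_two h2,
    mul_comm, ← exteriorPower.finrank_eq E 2]
  exact (Module.finrank_mul_finrank F E (⋀[E]^2 V)).symm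

theorem finrank_quotient_exteriorKer [Module.Finite E V] (h2 : (2 : E) ≠ 0) :
    Module.finrank F (liePower F V 2 ⧸ (exteriorKer F E V).toSubmodule) =
      (Module.finrank E V).choose 2 * Module.finrank F E := by
  rw [← finrank_range_tensorToExterior h2]
  exact LinearEquiv.finrank_eq (LinearMap.quotKerEquivRange _)

/-- The lower bound is the surjection onto the exterior square in the case `E = F`. -/
theorem finrank_liePower_two [Module.Finite F V] (h2 : (2 : F) ≠ 0) :
    Module.finrank F (liePower F V 2) = (Module.finrank F V).choose 2 := by
  refine le_antisymm finrank_liePower_two_le ?_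
  have h := finrank_range_tensorToExterior (F := F) (E := F) (V := V) h2
  rw [Module.finrank_self, mul_one] at h
  rw [← h]
  exact LinearMap.finrank_range_le _

end Exterior

end

noncomputable section

/-! ### Eigenvalues of scalar multiplication and dimension bounds -/

section Annihilator

open Polynomial TensorProduct

theorem LinearMap.aeval_comp_of_comp_eq {F M N : Type*} [Field F] [AddCommGroup M] [Module F M]
    [AddCommGroup N] [Module F N] {f : Module.End F M} {g : Module.End F N} {π : M →ₗ[F] N}
    (h : g ∘ₗ π = π ∘ₗ f) (P : F[X]) : aeval g P ∘ₗ π = π ∘ₗ aeval f P := by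
  induction P using Polynomial.induction_on' with
  | add p q hp hq => rw [map_add, map_add, LinearMap.add_comp, LinearMap.comp_add, hp, hq]
  | monomial n a =>
    have hn : (g ^ n) ∘ₗ π = π ∘ₗ (f ^ n) := by
      induction n with
      | zero => rfl
      | succ n ih =>
        rw [pow_succ, pow_succ, Module.End.mul_eq_comp, Module.End.mul_eq_comp,
          LinearMap.comp_assoc, h, ← LinearMap.comp_assoc, ih, LinearMap.comp_assoc]
    ext x
    have hx := LinearMap.congr_fun hn x
    simp only [LinearMap.comp_apply] at hx
    simp [aeval_monomial, hx]

/-- An operator on a nonzero space killed by a product of irreducible polynomials of degree `r`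
can only exist in dimension at least `r`. -/
theorem le_finrank_of_aeval_prod_eq_zero {F M : Type*} [Field F] [AddCommGroup M] [Module F M]
    [Module.Finite F M] [Nontrivial M] {r : ℕ} (T : Module.End F M) (s : Multiset F[X])
    (hs : ∀ P ∈ s, Irreducible P ∧ P.natDegree = r) (h : aeval T s.prod = 0) :
    r ≤ Module.finrank F M := by
  have hint : IsIntegral F T := Algebra.IsIntegral.isIntegral T
  -- An irreducible factor of the minimal polynomial is associated to a member of `s`, so it has
  -- degree `r`; it also divides the characteristic polynomial, whose degree is the dimension.
  obtain ⟨P, hP, hPdvd⟩ := exists_irreducible_of_natDegree_ne_zero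
    (minpoly.natDegree_pos hint).ne'
  obtain ⟨R, hR, hPR⟩ := hP.prime.exists_mem_multiset_dvd
    (hPdvd.trans (minpoly.dvd F T h))
  rw [← (hs R hR).2, ← natDegree_eq_of_degree_eq
    (degree_eq_degree_of_associated (hP.associated_of_dvd (hs R hR).1 hPR)),
    ← T.charpoly_natDegree]
  exact natDegree_le_of_dvd (hPdvd.trans T.minpoly_dvd_charpoly) T.charpoly_monic.ne_zero

theorem natDegree_minpoly_of_prime_finrank {F E : Type*} [Field F] [Field E] [Algebra F E]
    {r : ℕ} (hr : r.Prime) (hE : Module.finrank F E = r) {a : E}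
    (ha : a ∉ Set.range (algebraMap F E)) : (minpoly F a).natDegree = r := by
  have : Module.Finite F E := Module.finite_of_finrank_pos (hE ▸ hr.pos)
  have hint : IsIntegral F a := Algebra.IsIntegral.isIntegral a
  rcases (Nat.dvd_prime hr).1 (hE ▸ minpoly.degree_dvd hint) with h | h
  · exact absurd (minpoly.natDegree_eq_one_iff.1 h) ha
  · exact h

/-- Multiplying an element outside `F` by a conjugate never lands in `F`, for an extension of
odd prime degree. -/
theorem mul_conjugate_notMem_range {F E : Type*} [Field F] [Field E] [Algebra F E]
    [IsGalois F E] {r : ℕ} (hr : r.Prime) (h3 : 3 ≤ r) (hE : Module.finrank F E = r) {a b : E}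
    (ha : a ∉ Set.range (algebraMap F E)) (hb : aeval b (minpoly F a) = 0) :
    a * b ∉ Set.range (algebraMap F E) := by
  rintro ⟨c, hc⟩
  have : Module.Finite F E := Module.finite_of_finrank_pos (hE ▸ hr.pos)
  have ha0 : a ≠ 0 := by
    rintro rfl
    exact ha ⟨0, map_zero _⟩
  obtain ⟨σ, hσ⟩ := minpoly.exists_algEquiv_of_root' (Algebra.IsAlgebraic.isAlgebraic (R := F) a) hb
  have hb0 : b ≠ 0 := by
    rw [← hσ]
    exact (map_ne_zero σ).2 ha0
  have hσσ : σ (σ a) = a := by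
    have h := congrArg σ hc
    rw [AlgEquiv.commutes, hc, map_mul, hσ] at h
    rw [hσ]
    exact mul_left_cancel₀ hb0 (by rw [← h, mul_comm])
  have hpow : ∀ k, (σ ^ (2 * k)) a = a := by
    intro k
    induction k with
    | zero => simp
    | succ k ih => rw [mul_add, pow_add, AlgEquiv.mul_apply, mul_one, pow_two, AlgEquiv.mul_apply,
        hσσ, ih]
  have hab : b = a := by
    obtain ⟨k, hk⟩ := hr.odd_of_ne_two (by omega)
    have h : σ ^ r = 1 := by
      rw [← hE, ← IsGalois.card_aut_eq_finrank F E]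
      exact pow_card_eq_one'
    have h' := DFunLike.congr_fun h a
    rwa [hk, pow_succ', AlgEquiv.mul_apply, hpow, hσ] at h'
  have hroot : aeval a (X ^ 2 - C c) = 0 := by
    rw [map_sub, map_pow, aeval_X, aeval_C, hc, hab]
    ring
  have hdeg := natDegree_le_of_dvd (minpoly.dvd F a hroot) (X_pow_sub_C_ne_zero two_pos c)
  rw [natDegree_X_pow_sub_C, natDegree_minpoly_of_prime_finrank hr hE ha] at hdeg
  omega

/-- The product of the minimal polynomials of `a * b` over the conjugates `b` of `a`. -/
def conjProdPoly (F : Type*) {E : Type*} [Field F] [Field E] [Algebra F E] (a : E) :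
    Multiset F[X] :=
  ((minpoly F a).aroots E).map fun b => minpoly F (a * b)

/-- Splitting the minimal polynomial of `a` over the left factor gives `∏ (1 ⊗ a - b ⊗ 1) = 0`,
hence `∏ (a ⊗ a - ab ⊗ 1) = 0`. Each factor divides the minimal polynomial of `ab` evaluated at `a ⊗
a`, because `ab ⊗ 1` is a root of it. -/
theorem aeval_tmul_self_conjProdPoly {F E : Type*} [Field F] [Field E] [Algebra F E]
    [Module.Finite F E] [Normal F E] (a : E) :
    aeval (a ⊗ₜ[F] a : E ⊗[F] E) (conjProdPoly F a).prod = 0 := by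
  have hsplit : ((minpoly F a).map (algebraMap F E)).Splits := Normal.splits inferInstance a
  have hmonic : ((minpoly F a).map (algebraMap F E)).Monic :=
    (minpoly.monic (Algebra.IsIntegral.isIntegral a)).map _
  have hy : aeval (1 ⊗ₜ[F] a : E ⊗[F] E) (minpoly F a) = 0 := by
    have h := aeval_algHom_apply (Algebra.TensorProduct.includeRight : E →ₐ[F] E ⊗[F] E) a
      (minpoly F a)
    rw [minpoly.aeval, map_zero] at h
    exact h
  have h0 : (((minpoly F a).aroots E).map
      fun b => (1 ⊗ₜ[F] a - b ⊗ₜ[F] 1 : E ⊗[F] E)).prod = 0 := by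
    rw [← aeval_map_algebraMap E, hsplit.eq_prod_roots_of_monic hmonic, map_multiset_prod,
      Multiset.map_map] at hy
    simpa [Function.comp_def, aroots] using hy
  have h1 : (((minpoly F a).aroots E).map
      fun b => (a ⊗ₜ[F] a - (a * b) ⊗ₜ[F] 1 : E ⊗[F] E)).prod = 0 := by
    have : (fun b : E => (a ⊗ₜ[F] a - (a * b) ⊗ₜ[F] 1 : E ⊗[F] E)) =
        fun b => (a ⊗ₜ[F] 1) * (1 ⊗ₜ[F] a - b ⊗ₜ[F] 1) := by
      funext b
      simp [mul_sub]
    rw [this, Multiset.prod_map_mul, h0, mul_zero]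
  rw [conjProdPoly, map_multiset_prod, Multiset.map_map, ← zero_dvd_iff, ← h1]
  refine Multiset.prod_dvd_prod_of_dvd _ _ fun b _ => ?_
  have hz : aeval ((a * b) ⊗ₜ[F] 1 : E ⊗[F] E) (minpoly F (a * b)) = 0 := by
    have h := aeval_algHom_apply (Algebra.TensorProduct.includeLeft : E →ₐ[F] E ⊗[F] E) (a * b)
      (minpoly F (a * b))
    rw [minpoly.aeval, map_zero] at h
    exact h
  have h := sub_dvd_eval_sub (a ⊗ₜ[F] a : E ⊗[F] E) ((a * b) ⊗ₜ[F] 1)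
    ((minpoly F (a * b)).map (algebraMap F (E ⊗[F] E)))
  rwa [eval_map_algebraMap, eval_map_algebraMap, hz, sub_zero] at h

variable {F E V : Type*} [Field F] [Field E] [Algebra F E] [AddCommGroup V] [Module F V]
  [Module E V] [IsScalarTower F E V]

/-- Multiplication by a nonzero scalar of `E`, as an element of `ΓL(V)`. -/
def GammaL.scalar (F V : Type*) {E : Type*} [Field F] [Field E] [Algebra F E] [AddCommGroup V]
    [Module F V] [Module E V] [IsScalarTower F E V] (a : E) (ha : a ≠ 0) : GammaL F E V :=
  ⟨(LinearEquiv.smulOfNeZero E V a ha).restrictScalars F, 1, fun b v => smul_comm a b v⟩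

theorem GammaL.scalar_apply (a : E) (ha : a ≠ 0) (v : V) :
    (GammaL.scalar F V a ha : V ≃ₗ[F] V) v = a • v := rfl

/-- The degree 2 tensors are an image of `E ⊗ E`, on which the scalar `a` acts as multiplication by
`a ⊗ a`. -/
theorem aeval_scalar_conjProdPoly_apply [Module.Finite F E] [Normal F E] (κ : V ≃ₗ[E] E) (a : E)
    (ha : a ≠ 0) {x : TensorAlgebra F V}
    (hx : x ∈ (LinearMap.range (TensorAlgebra.ι F : V →ₗ[F] TensorAlgebra F V)) ^ 2) :
    aeval (tensorAlgebraMap (GammaL.scalar F V a ha : V ≃ₗ[F] V)).toLinearMap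
      (conjProdPoly F a).prod x = 0 := by
  let j : E →ₗ[F] TensorAlgebra F V :=
    TensorAlgebra.ι F ∘ₗ κ.symm.toLinearMap.restrictScalars F
  let π : E ⊗[F] E →ₗ[F] TensorAlgebra F V :=
    TensorProduct.lift ((LinearMap.mul F (TensorAlgebra F V)).compl₁₂ j j)
  have hπ : ∀ b c, π (b ⊗ₜ c) =
      TensorAlgebra.ι F (κ.symm b) * TensorAlgebra.ι F (κ.symm c) := fun b c => rfl
  have hrange : (LinearMap.range (TensorAlgebra.ι F : V →ₗ[F] TensorAlgebra F V)) ^ 2 ≤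
      LinearMap.range π := by
    rw [pow_two, Submodule.mul_le]
    rintro _ ⟨u, rfl⟩ _ ⟨v, rfl⟩
    exact ⟨κ u ⊗ₜ κ v, by simp [hπ]⟩
  obtain ⟨t, rfl⟩ := hrange hx
  have hcomm : (tensorAlgebraMap (GammaL.scalar F V a ha : V ≃ₗ[F] V)).toLinearMap ∘ₗ π =
      π ∘ₗ Algebra.lmul F (E ⊗[F] E) (a ⊗ₜ a) := by
    refine TensorProduct.ext' fun b c => ?_
    rw [LinearMap.comp_apply, LinearMap.comp_apply, Algebra.coe_lmul_eq_mul, LinearMap.mul_apply',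
      Algebra.TensorProduct.tmul_mul_tmul, hπ, hπ, AlgHom.toLinearMap_apply, map_mul,
      tensorAlgebraMap_ι, tensorAlgebraMap_ι, GammaL.scalar_apply, GammaL.scalar_apply,
      ← map_smul, ← map_smul, smul_eq_mul, smul_eq_mul]
  have h := LinearMap.congr_fun (LinearMap.aeval_comp_of_comp_eq hcomm (conjProdPoly F a).prod) t
  rw [LinearMap.comp_apply] at h
  rw [h, aeval_algHom_apply, aeval_tmul_self_conjProdPoly, map_zero, LinearMap.comp_apply,
    LinearMap.zero_apply, map_zero]

theorem aeval_liePowerRes_conjProdPoly [Module.Finite F E] [Normal F E] (κ : V ≃ₗ[E] E) (a : E)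
    (ha : a ≠ 0) :
    aeval (liePowerRes (GammaL F E V) 2 (GammaL.scalar F V a ha)) (conjProdPoly F a).prod = 0 := by
  have hcomm : (tensorAlgebraMap (GammaL.scalar F V a ha : V ≃ₗ[F] V)).toLinearMap ∘ₗ
      (liePower F V 2).subtype =
      (liePower F V 2).subtype ∘ₗ liePowerRes (GammaL F E V) 2 (GammaL.scalar F V a ha) := rfl
  ext x
  have h := LinearMap.congr_fun (LinearMap.aeval_comp_of_comp_eq hcomm (conjProdPoly F a).prod) x
  refine h.symm.trans ?_
  exact aeval_scalar_conjProdPoly_apply κ a ha x.2.1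

theorem exists_operator_of_prime_finrank [IsGalois F E] {r : ℕ} (hr : r.Prime) (h3 : 3 ≤ r)
    (hE : Module.finrank F E = r) (κ : V ≃ₗ[E] E) :
    ∃ (g : GammaL F E V) (s : Multiset F[X]), (∀ P ∈ s, Irreducible P ∧ P.natDegree = r) ∧
      aeval (liePowerRes (GammaL F E V) 2 g) s.prod = 0 := by
  have : Module.Finite F E := Module.finite_of_finrank_pos (hE ▸ hr.pos)
  obtain ⟨a, ha⟩ : ∃ a : E, a ∉ Set.range (algebraMap F E) := by
    by_contra! hcon
    have htop : (⊥ : Subalgebra F E) = ⊤ :=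
      Algebra.eq_top_iff.2 fun x => Algebra.mem_bot.2 (hcon x)
    have := Subalgebra.bot_eq_top_iff_finrank_eq_one.1 htop
    omega
  have ha0 : a ≠ 0 := by
    rintro rfl
    exact ha ⟨0, map_zero _⟩
  refine ⟨GammaL.scalar F V a ha0, conjProdPoly F a, ?_, aeval_liePowerRes_conjProdPoly κ a ha0⟩
  intro P hP
  obtain ⟨b, hb, rfl⟩ := Multiset.mem_map.1 hP
  exact ⟨minpoly.irreducible (Algebra.IsIntegral.isIntegral _),
    natDegree_minpoly_of_prime_finrank hr hE
      (mul_conjugate_notMem_range hr h3 hE ha (mem_aroots.1 hb).2)⟩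

theorem le_finrank_subrepresentation [IsGalois F E] [Module.Finite F V] {r : ℕ} (hr : r.Prime)
    (h3 : 3 ≤ r) (hE : Module.finrank F E = r) (κ : V ≃ₗ[E] E)
    (N : Subrepresentation (liePowerRes (GammaL F E V) 2)) (hN : N ≠ ⊥) :
    r ≤ Module.finrank F N.toSubmodule := by
  obtain ⟨g, s, hs, h⟩ := exists_operator_of_prime_finrank hr h3 hE κ
  have : Nontrivial N.toSubmodule := by
    rw [Submodule.nontrivial_iff_ne_bot]
    exact fun hbot => hN (Subrepresentation.toSubmodule_injective hbot)
  refine le_finrank_of_aeval_prod_eq_zero (N.toRepresentation g) s hs ?_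
  have hcomm : liePowerRes (GammaL F E V) 2 g ∘ₗ N.toSubmodule.subtype =
      N.toSubmodule.subtype ∘ₗ N.toRepresentation g := rfl
  have h' := LinearMap.aeval_comp_of_comp_eq hcomm s.prod
  rw [h, LinearMap.zero_comp] at h'
  ext x
  exact congrArg Subtype.val (LinearMap.congr_fun h' x).symm

theorem le_finrank_quotient [IsGalois F E] [Module.Finite F V] {r : ℕ} (hr : r.Prime)
    (h3 : 3 ≤ r) (hE : Module.finrank F E = r) (κ : V ≃ₗ[E] E)
    (N : Subrepresentation (liePowerRes (GammaL F E V) 2)) (hN : N ≠ ⊤) :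
    r ≤ Module.finrank F (liePower F V 2 ⧸ N.toSubmodule) := by
  obtain ⟨g, s, hs, h⟩ := exists_operator_of_prime_finrank hr h3 hE κ
  have : Nontrivial (liePower F V 2 ⧸ N.toSubmodule) := by
    rw [Submodule.Quotient.nontrivial_iff]
    exact fun htop => hN (Subrepresentation.toSubmodule_injective htop)
  refine le_finrank_of_aeval_prod_eq_zero
    (N.toSubmodule.mapQ N.toSubmodule (liePowerRes (GammaL F E V) 2 g)
      fun x hx => N.apply_mem_toSubmodule g hx) s hs ?_
  have h' := LinearMap.aeval_comp_of_comp_eq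
    (N.toSubmodule.mapQ_mkQ N.toSubmodule (liePowerRes (GammaL F E V) 2 g)
      (h := fun x hx => N.apply_mem_toSubmodule g hx)) s.prod
  rw [h, LinearMap.comp_zero] at h'
  exact LinearMap.range_eq_top.1 (Submodule.range_mkQ _) |> fun hsurj =>
    LinearMap.cancel_right hsurj |>.1 (h'.trans (LinearMap.zero_comp _).symm)

end Annihilator

end

noncomputable section

attribute [local instance] LieRing.ofAssociativeRing

/-! ### Reducibility, irreducibility and the four cases -/

section Main

theorem isIrreducible_of_forall_ne_bot {F G M : Type*} [Field F] [Group G] [AddCommGroup M]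
    [Module F M] (ρ : Representation F G M) [Nontrivial M]
    (h : ∀ N : Subrepresentation ρ, N ≠ ⊥ → N = ⊤) : ρ.IsIrreducible where
  exists_pair_ne := by
    refine ⟨⊥, ⊤, fun heq => ?_⟩
    exact bot_ne_top (α := Submodule F M) (congrArg Subrepresentation.toSubmodule heq)
  eq_bot_or_eq_top N := or_iff_not_imp_left.2 (h N)

theorem Subrepresentation.eq_top_of_finrank_le {F G M : Type*} [Field F] [Group G]
    [AddCommGroup M] [Module F M] [Module.Finite F M] {ρ : Representation F G M}
    (N : Subrepresentation ρ) (h : Module.finrank F M ≤ Module.finrank F N.toSubmodule) :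
    N = ⊤ :=
  Subrepresentation.toSubmodule_injective
    (Submodule.eq_top_of_finrank_eq (le_antisymm (Submodule.finrank_le _) h))

theorem Subrepresentation.ne_bot_of_finrank_quotient_lt {F G M : Type*} [Field F] [Group G]
    [AddCommGroup M] [Module F M] [Module.Finite F M] {ρ : Representation F G M}
    (N : Subrepresentation ρ)
    (h : Module.finrank F (M ⧸ N.toSubmodule) < Module.finrank F M) : N ≠ ⊥ := by
  rintro rfl
  have h' := Submodule.finrank_quotient_add_finrank (⊥ : Subrepresentation ρ).toSubmodule
  have hbot : (⊥ : Subrepresentation ρ).toSubmodule = ⊥ := rfl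
  rw [hbot, finrank_bot] at h'
  rw [hbot] at h
  omega

theorem Subrepresentation.ne_top_of_finrank_quotient_pos {F G M : Type*} [Field F] [Group G]
    [AddCommGroup M] [Module F M] {ρ : Representation F G M} (N : Subrepresentation ρ)
    (h : 0 < Module.finrank F (M ⧸ N.toSubmodule)) : N ≠ ⊤ := by
  rintro rfl
  have htop : (⊤ : Subrepresentation ρ).toSubmodule = ⊤ := rfl
  have hsub : Subsingleton (M ⧸ (⊤ : Subrepresentation ρ).toSubmodule) :=
    Submodule.Quotient.subsingleton_iff.2 htop
  rw [Module.finrank_zero_of_subsingleton] at h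
  exact h.ne rfl

theorem Nat.two_mul_choose_two (n : ℕ) : 2 * n.choose 2 = n * (n - 1) := by
  rw [Nat.choose_two_right]
  exact Nat.mul_div_cancel' (Nat.even_mul_pred_self n).two_dvd

theorem AlgEquiv.pow_finrank_eq_one {F E : Type*} [Field F] [Field E] [Algebra F E]
    [Module.Finite F E] [IsGalois F E] (σ : E ≃ₐ[F] E) : σ ^ Module.finrank F E = 1 := by
  rw [← IsGalois.card_aut_eq_finrank F E]
  exact pow_card_eq_one'

theorem exists_algEquiv_apply_ne {F E : Type*} [Field F] [Field E] [Algebra F E]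
    [Module.Finite F E] [IsGalois F E] (h : 1 < Module.finrank F E) :
    ∃ (σ : E ≃ₐ[F] E) (a : E), σ a ≠ a := by
  rw [← IsGalois.card_aut_eq_finrank F E] at h
  have : Nontrivial (E ≃ₐ[F] E) := Finite.one_lt_card_iff_nontrivial.1 h
  obtain ⟨σ, hσ⟩ := exists_ne (1 : E ≃ₐ[F] E)
  exact ⟨σ, not_forall.1 fun hall => hσ (AlgEquiv.ext hall)⟩

variable {F E V : Type*} [Field F] [Field E] [Algebra F E] [AddCommGroup V] [Module F V]
  [Module E V] [IsScalarTower F E V]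

theorem exteriorKer_ne_top_and_ne_bot [Module.Finite F V] [Module.Finite E V]
    [Module.Finite F E] (h2 : (2 : F) ≠ 0) (hE : 1 < Module.finrank F E)
    (hV : 1 < Module.finrank E V) : exteriorKer F E V ≠ ⊤ ∧ exteriorKer F E V ≠ ⊥ := by
  have h2E : (2 : E) ≠ 0 := by
    rw [← map_ofNat (algebraMap F E) 2]
    exact (map_ne_zero _).2 h2
  have hq := finrank_quotient_exteriorKer (F := F) (E := E) (V := V) h2E
  constructor
  · apply Subrepresentation.ne_top_of_finrank_quotient_pos
    rw [hq]
    exact Nat.mul_pos (Nat.choose_pos hV) (by omega)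
  · apply Subrepresentation.ne_bot_of_finrank_quotient_lt
    rw [hq, finrank_liePower_two h2, ← Module.finrank_mul_finrank F E V]
    generalize Module.finrank F E = r at *
    generalize Module.finrank E V = m at *
    have h1 := Nat.two_mul_choose_two m
    have h3 := Nat.two_mul_choose_two (r * m)
    have h4 : m - 1 < r * m - 1 := by
      have : 2 * m ≤ r * m := Nat.mul_le_mul_right m hE
      omega
    have h5 : r * m * (m - 1) < r * m * (r * m - 1) :=
      Nat.mul_lt_mul_of_pos_left h4 (Nat.mul_pos (by omega) (by omega))
    have h6 : 2 * (m.choose 2 * r) = r * m * (m - 1) := by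
      rw [← mul_assoc, h1]; ring
    omega

theorem lie_mem_liePower_two (a b : V) :
    ⁅TensorAlgebra.ι F a, TensorAlgebra.ι F b⁆ ∈ liePower F V 2 :=
  lie_mem_liePower (ι_mem_liePower_one a) (ι_mem_liePower_one b)

theorem lie_mem_liePower_three (a b c : V) :
    ⁅⁅TensorAlgebra.ι F a, TensorAlgebra.ι F b⁆, TensorAlgebra.ι F c⁆ ∈ liePower F V 3 :=
  lie_mem_liePower (lie_mem_liePower_two a b) (ι_mem_liePower_one c)

theorem lie_mem_liePower_four (a b c d : V) :
    ⁅⁅⁅TensorAlgebra.ι F a, TensorAlgebra.ι F b⁆, TensorAlgebra.ι F c⁆, TensorAlgebra.ι F d⁆ ∈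
      liePower F V 4 :=
  lie_mem_liePower (lie_mem_liePower_three a b c) (ι_mem_liePower_one d)

theorem finrank_quotient_weightKer_le [Module.Finite F E]
    (hcomm : ∀ σ τ : E ≃ₐ[F] E, σ * τ = τ * σ) {n : ℕ} (κ : V ≃ₗ[E] E)
    (s : Fin n → E ≃ₐ[F] E) :
    Module.finrank F (liePower F V n ⧸ (weightKer hcomm κ s).toSubmodule) ≤
      Module.finrank F E :=
  (LinearEquiv.finrank_eq (LinearMap.quotKerEquivRange _)).trans_le (Submodule.finrank_le _)

theorem weight_lie_one_ne_zero (κ : V ≃ₗ[E] E) {σ : E ≃ₐ[F] E} {a : E} (ha : σ a ≠ a) :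
    weight κ ![1, σ] ⁅TensorAlgebra.ι F (κ.symm 1), TensorAlgebra.ι F (κ.symm a)⁆ ≠ 0 := by
  rw [weight_lie_two]
  simpa [sub_eq_zero] using ha

theorem weight_lie_lie_one_ne_zero (κ : V ≃ₗ[E] E) (h2 : (2 : E) ≠ 0) {σ : E ≃ₐ[F] E} {a : E}
    (ha : σ a ≠ a) :
    weight κ ![1, σ, 1] ⁅⁅TensorAlgebra.ι F (κ.symm 1), TensorAlgebra.ι F (κ.symm a)⁆,
      TensorAlgebra.ι F (κ.symm 1)⁆ ≠ 0 := by
  rw [weight_lie_three]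
  simp
  intro h
  have h' : 2 * (σ a - a) = 0 := by linear_combination h
  simp [h2, sub_eq_zero, ha] at h'

theorem isReducibleRep_liePower_three [Module.Finite F E] [IsGalois F E] (κ : V ≃ₗ[E] E)
    (hcomm : ∀ σ τ : E ≃ₐ[F] E, σ * τ = τ * σ) (h2 : (2 : E) ≠ 0)
    (hE : Module.finrank F E = 3) :
    IsReducibleRep (liePowerRes (GammaL F E V) 3) := by
  obtain ⟨σ, a, ha⟩ := exists_algEquiv_apply_ne (F := F) (E := E) (by omega)
  have h3 : σ (σ (σ a)) = a := by
    have h := DFunLike.congr_fun σ.pow_finrank_eq_one a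
    rwa [hE] at h
  have ha0 : a ≠ 0 := by
    rintro rfl
    exact ha (map_zero σ)
  have hσ0 : σ a ≠ 0 := (map_ne_zero σ).2 ha0
  have ha2 : σ (σ a) ≠ a := by
    intro h
    rw [h] at h3
    exact ha h3
  refine ⟨weightKer hcomm κ ![1, σ, 1], ?_, ?_⟩
  -- A weight `(u, w, u)` sends `[[x, y], z]` to `2 u(z) (u(x) w(y) - u(y) w(x))`. For `(1, σ, 1)`
  -- both brackets give `2 a σ(a) (σ(a) - a)`. The weight `(σ, 1, σ)` separates them because `σ² a ≠
  -- a`.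
  · refine weightKer_ne_bot hcomm κ _ (sub_mem
      (lie_mem_liePower_three (κ.symm 1) (κ.symm a) (κ.symm (a * σ a)))
      (lie_mem_liePower_three (κ.symm a) (κ.symm (a * a)) (κ.symm 1))) ?_ ?_
    · rw [map_sub, weight_lie_three, weight_lie_three]
      simp
      ring
    · intro h
      have h' := congrArg (weight κ ![σ, 1, σ]) h
      rw [map_sub, weight_lie_three, weight_lie_three, map_zero] at h'
      simp at h'
      have h'' : 2 * σ a * (a - σ a) * (σ (σ a) - a) = 0 := by linear_combination h'
      simp [h2, hσ0, sub_eq_zero, ha2, ha.symm] at h''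
  · refine weightKer_ne_top hcomm κ _
      (lie_mem_liePower_three (κ.symm 1) (κ.symm a) (κ.symm 1)) ?_
    exact weight_lie_lie_one_ne_zero κ h2 ha

theorem isReducibleRep_liePower_four [Module.Finite F E] [IsGalois F E] (κ : V ≃ₗ[E] E)
    (hcomm : ∀ σ τ : E ≃ₐ[F] E, σ * τ = τ * σ) (h2 : (2 : E) ≠ 0) (h3 : (3 : E) ≠ 0)
    (hE : Module.finrank F E = 2) :
    IsReducibleRep (liePowerRes (GammaL F E V) 4) := by
  obtain ⟨σ, a, ha⟩ := exists_algEquiv_apply_ne (F := F) (E := E) (by omega)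
  have hσ : σ (σ a) = a := by
    have h := DFunLike.congr_fun σ.pow_finrank_eq_one a
    rwa [hE] at h
  refine ⟨weightKer hcomm κ ![1, σ, 1, σ], ?_, ?_⟩
  -- The last entry `d = a - σ a` satisfies `σ d = -d`, and the weight `(1, σ, 1, σ)` of the bracket
  -- is `2 (σ a - a) (σ d + d) = 0`. The weight `(1, σ, 1, 1)` is `3 (σ a - a) d`, nonzero since `3
  -- ≠ 0`.
  · refine weightKer_ne_bot hcomm κ _
      (lie_mem_liePower_four (κ.symm 1) (κ.symm a) (κ.symm 1) (κ.symm (a - σ a))) ?_ ?_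
    · rw [weight_lie_four]
      simp [hσ]
      ring
    · intro h
      have h' := congrArg (weight κ ![1, σ, 1, 1]) h
      rw [weight_lie_four, map_zero] at h'
      simp at h'
      have h'' : 3 * (σ a - a) * (a - σ a) = 0 := by linear_combination h'
      simp [h3, sub_eq_zero, ha, ha.symm] at h''
  · refine weightKer_ne_top hcomm κ _
      (lie_mem_liePower_four (κ.symm 1) (κ.symm a) (κ.symm 1) (κ.symm 1)) ?_
    rw [weight_lie_four]
    simp
    intro h
    have h' : 2 * 2 * (σ a - a) = 0 := by linear_combination h
    simp [h2, sub_eq_zero, ha] at h'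

theorem tensorAlgebraMap_injective (g : V ≃ₗ[F] V) : Function.Injective (tensorAlgebraMap g) := by
  refine Function.LeftInverse.injective (g := tensorAlgebraMap g⁻¹) fun x => ?_
  have h := DFunLike.congr_fun (tensorAlgebraMap_mul g⁻¹ g) x
  rw [inv_mul_cancel, tensorAlgebraMap_one] at h
  exact h.symm

/-- If `L²V` is spanned by `z`, every element of `L³V` is some `[z, v]`. The scalar of `E` taking
`w` to `v` sends `z` to a nonzero multiple of itself, hence `[z, w]` to a nonzero multiple of `[z,
v]`. -/
theorem isIrreducible_liePower_three [Module.Finite F V] (κ : V ≃ₗ[E] E)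
    (h3 : Nontrivial (liePower F V 3)) (h2 : Module.finrank F (liePower F V 2) = 1) :
    (liePowerRes (GammaL F E V) 3).IsIrreducible := by
  obtain ⟨⟨z, hz⟩, hz0, hz1⟩ := finrank_eq_one_iff'.1 h2
  have hspan : ∀ y ∈ liePower F V 2, ∃ c : F, c • z = y := fun y hy => by
    obtain ⟨c, hc⟩ := hz1 ⟨y, hy⟩
    exact ⟨c, congrArg Subtype.val hc⟩
  have hform : ∀ x ∈ liePower F V 3, ∃ v : V, ⁅z, TensorAlgebra.ι F v⁆ = x := by
    let f : V →ₗ[F] TensorAlgebra F V :=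
      (LinearMap.mulLeft F z - LinearMap.mulRight F z) ∘ₗ TensorAlgebra.ι F
    have hle : liePower F V 3 ≤ LinearMap.range f := by
      rw [liePower_eq_leftNormedSpan]
      refine Submodule.span_le.2 ?_
      rintro _ ⟨b, hb, v, rfl⟩
      rw [← liePower_eq_leftNormedSpan] at hb
      obtain ⟨c, rfl⟩ := hspan b hb
      exact ⟨c • v, by simp [f, LieRing.of_associative_ring_bracket, smul_sub]⟩
    exact fun x hx => hle hx
  refine isIrreducible_of_forall_ne_bot _ fun N hN => ?_
  obtain ⟨⟨x, hx⟩, hxN, hx0⟩ := N.toSubmodule.exists_mem_ne_zero_of_ne_bot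
    fun hbot => hN (Subrepresentation.toSubmodule_injective hbot)
  obtain ⟨w, rfl⟩ := hform x hx
  have hw : κ w ≠ 0 := by
    intro h
    rw [κ.map_eq_zero_iff] at h
    subst h
    exact hx0 (by simp)
  refine Subrepresentation.toSubmodule_injective (Submodule.eq_top_iff'.2 ?_)
  rintro ⟨y, hy⟩
  obtain ⟨v, rfl⟩ := hform y hy
  by_cases hv : v = 0
  · subst hv
    have h0 : (⟨⁅z, TensorAlgebra.ι F (0 : V)⁆, hy⟩ : liePower F V 3) = 0 :=
      Subtype.ext (by simp)
    rw [h0]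
    exact zero_mem _
  have he : κ v / κ w ≠ 0 := div_ne_zero (by simpa using hv) hw
  let g := GammaL.scalar F V (κ v / κ w) he
  have hgw : (g : V ≃ₗ[F] V) w = v := by
    rw [GammaL.scalar_apply]
    apply κ.injective
    rw [map_smul, smul_eq_mul, div_mul_cancel₀ _ hw]
  obtain ⟨c, hc⟩ := hspan _ (tensorAlgebraMap_mem_liePower (g : V ≃ₗ[F] V) 2 hz)
  have hc0 : c ≠ 0 := by
    rintro rfl
    rw [zero_smul, eq_comm, ← map_zero (tensorAlgebraMap (g : V ≃ₗ[F] V))] at hc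
    exact hz0 (Subtype.ext (tensorAlgebraMap_injective _ hc))
  have hmem := N.toSubmodule.smul_mem c⁻¹ (N.apply_mem_toSubmodule g hxN)
  convert hmem using 1
  apply Subtype.ext
  change ⁅z, TensorAlgebra.ι F v⁆ =
    c⁻¹ • tensorAlgebraMap (g : V ≃ₗ[F] V) ⁅z, TensorAlgebra.ι F w⁆
  rw [LieRing.of_associative_ring_bracket, LieRing.of_associative_ring_bracket, map_sub, map_mul,
    map_mul, tensorAlgebraMap_ι, hgw, ← hc, smul_mul_assoc, mul_smul_comm, ← smul_sub, smul_smul,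
    inv_mul_cancel₀ hc0, one_smul]

end Main

end

theorem mainTheorem7 {F E V : Type*} [Field F] [Finite F] [Field E] [Algebra F E]
    [AddCommGroup V] [Module F V] [Module E V] [IsScalarTower F E V]
    (p : ℕ) [CharP F p] (hp : 2 < p) (r d : ℕ) (hr : r.Prime)
    (hE : Module.finrank F E = r) (hV : Module.finrank F V = d) :
    (r < d →
      IsReducibleRep (liePowerRes (GammaL F E V) 2) ∧
        Nat.choose (d / r) 2 * r ∈ quotientDims (liePowerRes (GammaL F E V) 2)) ∧
    (3 < r → r = d →
      IsReducibleRep (liePowerRes (GammaL F E V) 2) ∧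
        IsLeast (quotientDims (liePowerRes (GammaL F E V) 2)) d) ∧
    (r = 3 → d = 3 → 3 < p →
      (liePowerRes (GammaL F E V) 2).IsIrreducible ∧
        IsReducibleRep (liePowerRes (GammaL F E V) 3)) ∧
    (r = 2 → d = 2 → 3 < p →
      (liePowerRes (GammaL F E V) 2).IsIrreducible ∧
        (liePowerRes (GammaL F E V) 3).IsIrreducible ∧
        IsReducibleRep (liePowerRes (GammaL F E V) 4)) := by
  have hEfin : Module.Finite F E := Module.finite_of_finrank_pos (hE ▸ hr.pos)
  have hEfinite : Finite E := Module.finite_of_finite F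
  have hcomm : ∀ σ τ : E ≃ₐ[F] E, σ * τ = τ * σ := fun σ τ =>
    IsMulCommutative.is_comm.comm σ τ
  have h2 : (2 : F) ≠ 0 := fun h => by
    have := Nat.le_of_dvd two_pos ((CharP.cast_eq_zero_iff F p 2).1 (by exact_mod_cast h))
    omega
  have h2E : (2 : E) ≠ 0 := by
    rw [← map_ofNat (algebraMap F E) 2]
    exact (map_ne_zero _).2 h2
  have hdim : r * Module.finrank E V = d := by rw [← hE, ← hV, Module.finrank_mul_finrank]
  have hVfin : 0 < d → Module.Finite F V ∧ Module.Finite E V := fun hd => by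
    have h : Module.Finite F V := Module.finite_of_finrank_pos (hV ▸ hd)
    exact ⟨h, Module.Finite.of_restrictScalars_finite F E V⟩
  have hκ : r = d → Nonempty (V ≃ₗ[E] E) := fun hrd => by
    have := (hVfin (hrd ▸ hr.pos)).2
    refine ⟨LinearEquiv.ofFinrankEq V E ?_⟩
    rw [Module.finrank_self]
    exact Nat.eq_of_mul_eq_mul_left hr.pos (by rw [hdim, mul_one, hrd])
  refine ⟨fun hrd => ?_, fun h3 hrd => ?_, fun hr3 hd hp3 => ?_, fun hr2 hd hp3 => ?_⟩
  · obtain ⟨_, _⟩ := hVfin (by omega)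
    have hm : 1 < Module.finrank E V := by
      by_contra hle
      have : r * Module.finrank E V ≤ r * 1 := Nat.mul_le_mul_left r (by omega)
      omega
    obtain ⟨htop, hbot⟩ := exteriorKer_ne_top_and_ne_bot (V := V) h2 (hE ▸ hr.one_lt) hm
    refine ⟨⟨_, hbot, htop⟩, _, htop, ?_⟩
    rw [finrank_quotient_exteriorKer h2E, hE, ← hdim, Nat.mul_div_cancel_left _ hr.pos]
  · obtain ⟨_, _⟩ := hVfin (by omega)
    obtain ⟨κ⟩ := hκ hrd
    obtain ⟨σ, a, ha⟩ := exists_algEquiv_apply_ne (F := F) (E := E) (by omega)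
    have htop := weightKer_ne_top (n := 2) hcomm κ ![1, σ] (lie_mem_liePower_two _ _)
      (weight_lie_one_ne_zero κ ha)
    -- The quotient embeds in `E`, so its dimension is at most `r`; the eigenvalue bound forces
    -- equality.
    have hle := finrank_quotient_weightKer_le (n := 2) hcomm κ ![1, σ]
    have hge := le_finrank_quotient hr (by omega) hE κ _ htop
    refine ⟨⟨_, ?_, htop⟩, ⟨_, htop, by omega⟩, ?_⟩
    · apply Subrepresentation.ne_bot_of_finrank_quotient_lt
      rw [finrank_liePower_two h2, hV]
      have h4 := Nat.two_mul_choose_two d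
      -- Here `d > 3` is needed: for `d = 3` the dimension `choose d 2` equals `d` and the kernel
      -- could vanish.
      have h5 : d * 3 ≤ d * (d - 1) := Nat.mul_le_mul_left d (by omega)
      omega
    · rintro k ⟨N, hN, rfl⟩
      exact hrd ▸ le_finrank_quotient hr (by omega) hE κ N hN
  · obtain ⟨_, _⟩ := hVfin (by omega)
    obtain ⟨κ⟩ := hκ (by omega)
    refine ⟨?_, isReducibleRep_liePower_three κ hcomm h2E (by omega)⟩
    have hL : Module.finrank F (liePower F V 2) = 3 := by
      rw [finrank_liePower_two h2, hV, hd]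
      rfl
    have : Nontrivial (liePower F V 2) := Module.nontrivial_of_finrank_pos (R := F) (by omega)
    refine isIrreducible_of_forall_ne_bot _ fun N hN => N.eq_top_of_finrank_le ?_
    rw [hL, ← hr3]
    exact le_finrank_subrepresentation hr hr3.ge hE κ N hN
  · obtain ⟨_, _⟩ := hVfin (by omega)
    obtain ⟨κ⟩ := hκ (by omega)
    have hL : Module.finrank F (liePower F V 2) = 1 := by
      rw [finrank_liePower_two h2, hV, hd]
      rfl
    have h3E : (3 : E) ≠ 0 := by
      rw [← map_ofNat (algebraMap F E) 3]
      refine (map_ne_zero _).2 fun h => ?_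
      have := Nat.le_of_dvd three_pos ((CharP.cast_eq_zero_iff F p 3).1 (by exact_mod_cast h))
      omega
    refine ⟨?_, ?_, isReducibleRep_liePower_four κ hcomm h2E h3E (by omega)⟩
    · have : Nontrivial (liePower F V 2) := Module.nontrivial_of_finrank_pos (R := F) (by omega)
      refine isIrreducible_of_forall_ne_bot _ fun N hN => N.eq_top_of_finrank_le ?_
      rw [hL, Nat.one_le_iff_ne_zero, Ne, Submodule.finrank_eq_zero]
      exact fun hbot => hN (Subrepresentation.toSubmodule_injective hbot)
    · obtain ⟨σ, a, ha⟩ := exists_algEquiv_apply_ne (F := F) (E := E) (by omega)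
      refine isIrreducible_liePower_three κ ?_ hL
      refine ⟨⟨_, lie_mem_liePower_three (κ.symm 1) (κ.symm a) (κ.symm 1)⟩, 0, fun h => ?_⟩
      exact weight_lie_lie_one_ne_zero κ h2E ha
        ((congrArg (fun x : liePower F V 3 => weight κ ![1, σ, 1] x.1) h).trans (map_zero _))
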